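/- Let $d\ge 3$ and $u>0$, and let $A\subset\mathbb{Z}^d$ be finite and nonempty. Write $x\sim y$ if $\|x-y\|=1$ (Euclidean norm), let $\partial A=\{x\in A:\ \exists\, y\notin A,\ x\sim y\}$, and let $P_x$ be the law of simple random walk $(S_n)_{n\ge 0}$ on $\mathbb{Z}^d$ started from $x$. Put $e_A(x)=P_x[S_k\notin A\ \text{for all}\ k\ge 1]\,\mathbf 1_{\{x\in A\}}$ and $\mathrm{cap}(A)=\sum_{x\in A}e_A(x)$. Random interlacements at level $u$ observed on $A$ are given by a Poisson$(u\,\mathrm{cap}(A))$ number of particles, which start at independent points of $A$ with law $e_A(\cdot)/\mathrm{cap}(A)$ and then perform independent simple random walks (all these choices being independent); let $\mathbf P$ be the corresponding probability. For $x\in A$ let $\mathcal L^u_A(x)$ be the local time at $x$, i.e. the total number of visits to $x$ at times $0,1,2,\dots$ by all these walks. Let $x_0\in A$, $m\ge 0$, and let $x_0=y_0\sim y_1\sim\cdots\sim y_m=x_0$ be a nearest-neighbour path with $y_k\in A\setminus\partial A$ for all $k=0,\dots,m$. Put $\ell(x)=\sum_{k=1}^m\mathbf 1\{y_k=x\}$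 for $x\in A$. Then for every $\eta\in\{0,1,2,\dots\}^A$ with $\eta(x_0)=1$, $$\mathbf P[\mathcal L^u_A=\eta+\ell]\ \ge\ (2d)^{-m}\,\mathbf P[\mathcal L^u_A=\eta].$$ -/

import Mathlib

open MeasureTheory ProbabilityTheory
open scoped NNReal ENNReal

namespace Interlacement

/-- The lattice `ℤ^d`, with its discrete (product) σ-algebra. -/
abbrev Lattice (d : ℕ) : Type := Fin d → ℤ

/-- `x ∼ y`: the sites `x` and `y` are at Euclidean distance `1` from each other. -/
def Adj {d : ℕ} (x y : Lattice d) : Prop := ∑ i, (x i - y i) ^ 2 = 1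

/-- The inner boundary `∂V = {x ∈ V : there is y ∉ V with x ∼ y}`. -/
def innerBoundary {d : ℕ} (V : Set (Lattice d)) : Set (Lattice d) :=
  {x | x ∈ V ∧ ∃ y, y ∉ V ∧ Adj x y}

/-- The law of one step of simple random walk: uniform on the `2d` neighbours of the origin. -/
noncomputable def stepLaw (d : ℕ) : Measure (Lattice d) :=
  uniformOn {z : Lattice d | Adj 0 z}

/-- The law of an infinite sequence of independent steps of simple random walk. -/
noncomputable def stepsLaw (d : ℕ) : Measure (ℕ → Lattice d) :=
  Measure.infinitePi fun _ : ℕ => stepLaw d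

/-- The trajectory that starts from `x` and has the steps `ξ 0, ξ 1, …`:
its position at time `n` is `x + ξ 0 + ⋯ + ξ (n - 1)`. -/
def walk {d : ℕ} (x : Lattice d) (ξ : ℕ → Lattice d) (n : ℕ) : Lattice d :=
  x + ∑ i ∈ Finset.range n, ξ i

/-- The law `P_x` of simple random walk started from `x`, a measure on trajectories. -/
noncomputable def srwLaw {d : ℕ} (x : Lattice d) : Measure (ℕ → Lattice d) :=
  (stepsLaw d).map (walk x)

/-- The hitting time `T_A = min {k ≥ 1 : S_k ∈ A}` of a trajectory `S`, with `min ∅ = ∞`. -/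
noncomputable def hittingTime {d : ℕ} (A : Set (Lattice d)) (S : ℕ → Lattice d) : ℕ∞ :=
  sInf {t : ℕ∞ | ∃ k : ℕ, 1 ≤ k ∧ S k ∈ A ∧ t = k}

/-- The (unnormalized) harmonic measure `e_A(x) = P_x[T_A = ∞]` for `x ∈ A`, and `0` off `A`. -/
noncomputable def harmonicMeasure {d : ℕ} (A : Finset (Lattice d)) (x : Lattice d) : ℝ≥0 :=
  if x ∈ A then (srwLaw x {S | hittingTime (A : Set (Lattice d)) S = ⊤}).toNNReal else 0

/-- The capacity `cap(A) = ∑_{x ∈ A} e_A(x)`. -/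
noncomputable def capacity {d : ℕ} (A : Finset (Lattice d)) : ℝ≥0 :=
  ∑ x ∈ A, harmonicMeasure A x

/-- The normalized harmonic measure, which puts mass `e_A(x) / cap(A)` on each `x ∈ A`. -/
noncomputable def normalizedHarmonicMeasure {d : ℕ} (A : Finset (Lattice d)) :
    Measure (Lattice d) :=
  ∑ x ∈ A, (harmonicMeasure A x / capacity A) • Measure.dirac x

/-- A configuration of random interlacements observed on a finite set: the number of particles,
the starting points of the particles, and their steps. Only the particles with index smaller than
`number` are present. It is the type of triples `(number, start, steps)`. -/
abbrev Config (d : ℕ) : Type := ℕ × (ℕ → Lattice d) × (ℕ → ℕ → Lattice d)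

/-- The law of random interlacements at level `u` observed on the finite set `A`: a
Poisson(`u cap(A)`) number of particles, independent starting points with law
`e_A / cap(A)`, and independent simple random walks from these starting points. -/
noncomputable def interlacementLaw {d : ℕ} (A : Finset (Lattice d)) (u : ℝ≥0) :
    Measure (Config d) :=
  (poissonMeasure (u * capacity A)).prod
    ((Measure.infinitePi fun _ : ℕ => normalizedHarmonicMeasure A).prod
      (Measure.infinitePi fun _ : ℕ => stepsLaw d))

/-- The local time at `x`: the total number of visits to `x`, at times `0, 1, 2, …`, of the
trajectories of all particles that are present. -/
noncomputable def localTime {d : ℕ} (ω : Config d) (x : Lattice d) : ℕ∞ :=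
  ∑ k ∈ Finset.range ω.1, {n : ℕ | walk (ω.2.1 k) (ω.2.2 k) n = x}.encard

/-- The event that the local time configuration on `A` equals `η`. -/
def localTimeEvent {d : ℕ} (A : Finset (Lattice d)) (η : A → ℕ) : Set (Config d) :=
  {ω | ∀ x : A, localTime ω x = η x}

/-- The local time `ℓ(x) = ∑_{k=1}^m 1{y_k = x}` on `A` of the path `y_0, …, y_m`. -/
def loopLocalTime {d : ℕ} (A : Finset (Lattice d)) (m : ℕ) (y : ℕ → Lattice d) : A → ℕ :=
  fun x => ∑ k ∈ Finset.Icc 1 m, if y k = x then 1 else 0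

end Interlacement

/-! Splice the loop into the trajectory of the lowest-indexed particle that visits `x₀`, at its
first visit there. The loop returns to its starting point, so the rest of the trajectory is only
delayed by `m` steps and the local time grows by exactly `ℓ`.

For fixed particle `k` and time `n`, the splicing map `T` satisfies `(2d)^{-m} • T_* P ≤ P`:
inserting an independent random step into an i.i.d. sequence preserves its law, and a prescribed
step has probability at least `1/(2d)` (`smul_map_insertBlock_le`, `smul_map_insertLoop_le`). Such a
domination yields lower bounds on events without any injectivity of `T`.

Since `η x₀ ≠ 0`, the pairs `(k, n)` partition the event for `η`. Splicing does not change which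
visit is first, so the image pieces are disjoint too, and the bounds add up
(`smul_interlacementLaw_le`). -/

namespace Interlacement

/-! ### Inserting entries into an i.i.d. sequence. -/

section Insertion

variable {S : Type*}

/-- The sequence `ξ` with the new entry `b` inserted at position `n`. -/
def insertAt (n : ℕ) (b : S) (ξ : ℕ → S) (i : ℕ) : S :=
  if i < n then ξ i else if i = n then b else ξ (i - 1)

/-- The sequence `ξ` with the block `a 0, …, a (m - 1)` inserted at position `n`. -/
def insertBlock (n m : ℕ) (a ξ : ℕ → S) (i : ℕ) : S :=
  if i < n then ξ i else if i < n + m then a (i - n) else ξ (i - m)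

lemma insertBlock_zero (n : ℕ) (a : ℕ → S) : insertBlock n 0 a = id := by
  funext ξ i
  by_cases h : i < n <;> simp [insertBlock, h]

lemma insertBlock_succ (n m : ℕ) (a : ℕ → S) :
    insertBlock n (m + 1) a = insertAt (n + m) (a m) ∘ insertBlock n m a := by
  funext ξ i
  simp only [insertBlock, insertAt, Function.comp_apply]
  rcases lt_trichotomy i (n + m) with h | rfl | h
  · split_ifs <;> first | rfl | omega
  · simp
  · have : i - 1 - m = i - (m + 1) := by omega
    rw [this]
    split_ifs <;> first | rfl | omega

variable [MeasurableSpace S]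

@[fun_prop]
lemma measurable_insertAt (n : ℕ) :
    Measurable fun p : S × (ℕ → S) => insertAt n p.1 p.2 := by
  refine measurable_pi_lambda _ fun i => ?_
  unfold insertAt
  split_ifs <;> fun_prop

lemma measurable_insertAt_right (n : ℕ) (b : S) : Measurable (insertAt n b) :=
  (measurable_insertAt n).comp measurable_prodMk_left

lemma measurable_insertBlock (n m : ℕ) (a : ℕ → S) : Measurable (insertBlock n m a) := by
  refine measurable_pi_lambda _ fun i => ?_
  unfold insertBlock
  split_ifs <;> fun_prop

/-- A fresh independent entry leaves an i.i.d. sequence i.i.d.: the preimage of a finite box is a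
condition on the new entry times a box in the old ones. -/
lemma map_insertAt_prod_infinitePi (μ : Measure S) [IsProbabilityMeasure μ] (n : ℕ) :
    (μ.prod (Measure.infinitePi fun _ : ℕ => μ)).map (fun p => insertAt n p.1 p.2) =
      Measure.infinitePi fun _ : ℕ => μ := by
  refine Measure.eq_infinitePi _ fun s t ht => ?_
  classical
  -- Old index to new index; its range is everything except `n`.
  let f : ℕ → ℕ := fun j => if j < n then j else j + 1
  have hf : Function.Injective f := by
    intro i j h
    simp only [f] at h
    split_ifs at h <;> omega
  have hfn (j : ℕ) : f j ≠ n := by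
    simp only [f]
    split_ifs <;> omega
  have hrange (i : ℕ) (hi : i ≠ n) : ∃ j, f j = i := by
    rcases lt_or_gt_of_ne hi with h | h
    · exact ⟨i, by simp [f, h]⟩
    · exact ⟨i - 1, by simp only [f]; split_ifs <;> omega⟩
  have hins_f (b : S) (ξ : ℕ → S) (j : ℕ) : insertAt n b ξ (f j) = ξ j := by
    by_cases hj : j < n
    · simp [insertAt, f, hj]
    · have h1 : ¬ j + 1 < n := by omega
      have h2 : j + 1 ≠ n := by omega
      simp [insertAt, f, hj, h1, h2]
  have hins_n (b : S) (ξ : ℕ → S) : insertAt n b ξ n = b := by simp [insertAt]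
  have hpre : (fun p : S × (ℕ → S) => insertAt n p.1 p.2) ⁻¹' Set.pi s t =
      {b | n ∈ s → b ∈ t n} ×ˢ
        Set.pi (s.preimage f hf.injOn : Finset ℕ) (fun j => t (f j)) := by
    ext ⟨b, ξ⟩
    simp only [Set.mem_preimage, Set.mem_pi, Finset.mem_coe, Set.mem_prod, Set.mem_ofPred_eq,
      Finset.mem_preimage]
    refine ⟨fun h => ⟨fun hn => hins_n b ξ ▸ h n hn, fun j hj => hins_f b ξ j ▸ h _ hj⟩, ?_⟩
    rintro ⟨h1, h2⟩ i hi
    by_cases hin : i = n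
    · subst hin
      rw [hins_n]
      exact h1 hi
    · obtain ⟨j, rfl⟩ := hrange i hin
      rw [hins_f]
      exact h2 j hi
  rw [Measure.map_apply (measurable_insertAt n)
    (MeasurableSet.pi s.countable_toSet fun i _ => ht i), hpre, Measure.prod_prod,
    Measure.infinitePi_pi _ fun i _ => ht (f i),
    Finset.prod_preimage' f s hf.injOn fun i => μ (t i)]
  have hfilter : s.filter (· ∈ Set.range f) = s.erase n := by
    ext i
    simp only [Finset.mem_filter, Set.mem_range, Finset.mem_erase]
    constructor
    · rintro ⟨hi, j, rfl⟩
      exact ⟨hfn j, hi⟩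
    · rintro ⟨hin, hi⟩
      exact ⟨hi, hrange i hin⟩
  rw [hfilter]
  by_cases hn : n ∈ s
  · simpa [hn] using Finset.mul_prod_erase s (fun i => μ (t i)) hn
  · simp [hn]

/-- Inserting a random entry preserves the law; keeping only the atom `{b}` in the integral over
that entry gives the bound. -/
lemma smul_map_insertAt_le [MeasurableSingletonClass S] (μ : Measure S) [IsProbabilityMeasure μ]
    (n : ℕ) (b : S) :
    μ {b} • (Measure.infinitePi fun _ : ℕ => μ).map (insertAt n b) ≤
      Measure.infinitePi fun _ : ℕ => μ := by
  refine Measure.le_iff.2 fun E hE => ?_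
  conv_rhs => rw [← map_insertAt_prod_infinitePi μ n]
  rw [Measure.map_apply (measurable_insertAt n) hE,
    Measure.prod_apply (measurable_insertAt n hE), Measure.smul_apply,
    Measure.map_apply (measurable_insertAt_right n b) hE, smul_eq_mul, mul_comm]
  refine le_trans (le_of_eq ?_) (setLIntegral_le_lintegral {b} _)
  rw [lintegral_singleton]
  rfl

lemma smul_map_insertBlock_le [MeasurableSingletonClass S] (μ : Measure S)
    [IsProbabilityMeasure μ] (n m : ℕ) (a : ℕ → S) :
    (∏ i ∈ Finset.range m, μ {a i}) •
        (Measure.infinitePi fun _ : ℕ => μ).map (insertBlock n m a) ≤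
      Measure.infinitePi fun _ : ℕ => μ := by
  induction m with
  | zero => simp [insertBlock_zero]
  | succ m ih =>
    rw [insertBlock_succ, ← Measure.map_map (measurable_insertAt_right _ _)
      (measurable_insertBlock n m a), Finset.prod_range_succ, mul_comm, mul_smul,
      ← Measure.map_smul]
    refine le_trans ?_ (smul_map_insertAt_le μ (n + m) (a m))
    gcongr
    exact measurable_insertAt_right _ _

end Insertion

/-! ### Changing one coordinate of an i.i.d. sequence. -/

section Coordinate

variable {S : Type*} [MeasurableSpace S]

lemma map_update_prod_infinitePi (μ ν : Measure S) [IsProbabilityMeasure μ]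
    [IsProbabilityMeasure ν] (k : ℕ) :
    ((Measure.infinitePi fun _ : ℕ => μ).prod ν).map
        (fun p : (ℕ → S) × S => Function.update p.1 k p.2) =
      Measure.infinitePi (Function.update (fun _ : ℕ => μ) k ν) := by
  have (i : ℕ) : IsProbabilityMeasure (Function.update (fun _ : ℕ => μ) k ν i) := by
    by_cases h : i = k
    · subst h; simpa
    · simpa [h]
  refine Measure.eq_infinitePi _ fun s t ht => ?_
  have hpre : (fun p : (ℕ → S) × S => Function.update p.1 k p.2) ⁻¹' Set.pi s t =
      Set.pi (s.erase k : Finset ℕ) t ×ˢ {b | k ∈ s → b ∈ t k} := by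
    ext ⟨ω, b⟩
    simp only [Set.mem_preimage, Set.mem_pi, Finset.mem_coe, Set.mem_prod, Set.mem_ofPred_eq,
      Finset.mem_erase]
    refine ⟨fun h => ⟨fun i hi => by simpa [hi.1] using h i hi.2,
      fun hk => by simpa using h k hk⟩, ?_⟩
    rintro ⟨h1, h2⟩ i hi
    by_cases hik : i = k
    · subst hik; simpa using h2 hi
    · simpa [hik] using h1 i ⟨hik, hi⟩
  rw [Measure.map_apply (by fun_prop) (MeasurableSet.pi s.countable_toSet fun i _ => ht i), hpre,
    Measure.prod_prod, Measure.infinitePi_pi _ fun i _ => ht i]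
  have hne : ∏ i ∈ s.erase k, Function.update (fun _ : ℕ => μ) k ν i (t i) =
      ∏ i ∈ s.erase k, μ (t i) :=
    Finset.prod_congr rfl fun i hi => by simp [Finset.ne_of_mem_erase hi]
  by_cases hk : k ∈ s
  · rw [← Finset.prod_erase_mul s _ hk, hne]
    simp [hk]
  · rw [Finset.erase_eq_of_notMem hk] at hne ⊢
    simp [hk, hne]

/-- If `T` distorts `μ` by a factor of at most `c⁻¹`, then so does the application of `T` to a
single coordinate of a sequence with law `μ^ℕ`. -/
lemma smul_map_update_le (μ : Measure S) [IsProbabilityMeasure μ] {c : ℝ≥0∞} {T : S → S}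
    (hT : Measurable T) (h : c • μ.map T ≤ μ) (k : ℕ) :
    c • (Measure.infinitePi fun _ : ℕ => μ).map (fun ω => Function.update ω k (T (ω k))) ≤
      Measure.infinitePi fun _ : ℕ => μ := by
  have hQ := map_update_prod_infinitePi μ μ k
  rw [Function.update_eq_self] at hQ
  have hU : Measurable fun p : (ℕ → S) × S => Function.update p.1 k p.2 := by fun_prop
  have hV : Measurable fun ω : ℕ → S => Function.update ω k (T (ω k)) := by fun_prop
  refine Measure.le_iff.2 fun E hE => ?_
  -- Resampling coordinate `k` preserves the law, so it suffices to compare the sections in that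
  -- coordinate, where `h` applies.
  have hcalc (F : Set (ℕ → S)) (hF : MeasurableSet F) :
      (Measure.infinitePi fun _ : ℕ => μ) F = ∫⁻ ω, μ (Function.update ω k ⁻¹' F)
        ∂(Measure.infinitePi fun _ : ℕ => μ) := by
    conv_lhs => rw [← hQ]
    rw [Measure.map_apply hU hF, Measure.prod_apply (hU hF)]
    rfl
  have hsec (ω : ℕ → S) : MeasurableSet (Function.update ω k ⁻¹' E) :=
    measurable_update ω hE
  have hmeas : Measurable fun ω : ℕ → S =>
      μ (Function.update ω k ⁻¹' ((fun ω => Function.update ω k (T (ω k))) ⁻¹' E)) :=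
    measurable_measure_prodMk_left (hU (hV hE))
  rw [Measure.smul_apply, Measure.map_apply hV hE, hcalc _ (hV hE), hcalc _ hE, smul_eq_mul,
    ← lintegral_const_mul _ hmeas]
  refine lintegral_mono fun ω => ?_
  have : Function.update ω k ⁻¹' ((fun ω => Function.update ω k (T (ω k))) ⁻¹' E) =
      T ⁻¹' (Function.update ω k ⁻¹' E) := by
    ext b
    simp
  rw [this, ← Measure.map_apply hT (hsec ω)]
  exact h _

end Coordinate

end Interlacement

namespace Interlacement

/-! ### Single steps: at most `2d` neighbours, so each has mass at least `1/(2d)`. -/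

section StepLaw

variable {d : ℕ}

lemma exists_eq_single_of_adj_zero {z : Lattice d} (h : Adj 0 z) :
    ∃ (i : Fin d) (s : ℤˣ), z = Pi.single i (s : ℤ) := by
  have h' : ∑ i, z i ^ 2 = 1 := by simpa [Adj] using h
  obtain ⟨i, -, hi⟩ : ∃ i ∈ Finset.univ, z i ^ 2 ≠ 0 :=
    Finset.exists_ne_zero_of_sum_ne_zero (by rw [h']; exact one_ne_zero)
  have hpos : 1 ≤ z i ^ 2 := by
    have := sq_nonneg (z i)
    omega
  have hsum := Finset.add_sum_erase Finset.univ (fun j => z j ^ 2) (Finset.mem_univ i)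
  have hrest : ∑ j ∈ Finset.univ.erase i, z j ^ 2 = 0 := by
    have : 0 ≤ ∑ j ∈ Finset.univ.erase i, z j ^ 2 := Finset.sum_nonneg fun j _ => sq_nonneg _
    omega
  have hone : z i ^ 2 = 1 := by
    omega
  have hzero : ∀ j ≠ i, z j = 0 := fun j hj => by
    simpa using (Finset.sum_eq_zero_iff_of_nonneg fun j _ => sq_nonneg (z j)).1 hrest j
      (Finset.mem_erase.2 ⟨hj, Finset.mem_univ j⟩)
  refine ⟨i, (IsUnit.of_mul_eq_one (z i) (by rw [← sq, hone])).unit, ?_⟩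
  ext j
  by_cases hj : j = i
  · subst hj; simp
  · simp [hj, hzero j hj]

lemma adj_zero_subset_range :
    {z : Lattice d | Adj 0 z} ⊆
      Set.range fun p : Fin d × ℤˣ => (Pi.single p.1 (p.2 : ℤ) : Lattice d) := by
  intro z hz
  obtain ⟨i, s, rfl⟩ := exists_eq_single_of_adj_zero hz
  exact ⟨(i, s), rfl⟩

lemma finite_adj_zero : {z : Lattice d | Adj 0 z}.Finite :=
  (Set.finite_range _).subset adj_zero_subset_range

lemma encard_adj_zero_le : {z : Lattice d | Adj 0 z}.encard ≤ (2 * d : ℕ) := by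
  refine (Set.encard_le_encard adj_zero_subset_range).trans ?_
  rw [← Set.image_univ]
  refine (Set.encard_image_le _ _).trans ?_
  simp [Set.encard_univ, mul_comm]

lemma isProbabilityMeasure_stepLaw (hd : 0 < d) : IsProbabilityMeasure (stepLaw d) := by
  refine isProbabilityMeasure_uniformOn finite_adj_zero
    ⟨Pi.single (⟨0, hd⟩ : Fin d) 1, ?_⟩
  simp [Adj, Pi.single_apply]

lemma inv_two_mul_le_stepLaw_singleton {z : Lattice d} (hz : Adj 0 z) :
    (2 * d : ℝ≥0∞)⁻¹ ≤ stepLaw d {z} := by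
  have hs : MeasurableSet {z : Lattice d | Adj 0 z} := finite_adj_zero.measurableSet
  have hz' : {z} ⊆ {z : Lattice d | Adj 0 z} := Set.singleton_subset_iff.2 hz
  rw [stepLaw, uniformOn, cond_apply hs, Set.inter_eq_right.2 hz',
    Measure.count_singleton, mul_one, ENNReal.inv_le_inv, Measure.count_apply hs]
  exact_mod_cast ENat.toENNReal_le.2 (encard_adj_zero_le (d := d))

lemma Adj.sub {x y : Lattice d} (h : Adj x y) : Adj 0 (y - x) := by
  simpa [Adj] using h

end StepLaw

/-! ### Splicing a loop into one walk. -/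

section Walk

variable {d : ℕ}

lemma walk_succ (x : Lattice d) (ξ : ℕ → Lattice d) (n : ℕ) :
    walk x ξ (n + 1) = walk x ξ n + ξ n := by
  simp [walk, Finset.sum_range_succ, add_assoc]

/-- The steps of the path `y`. -/
def pathSteps (y : ℕ → Lattice d) (i : ℕ) : Lattice d := y (i + 1) - y i

variable {x : Lattice d} {ξ y : ℕ → Lattice d} {n m : ℕ}

lemma walk_insertBlock_of_le (a : ℕ → Lattice d) {j : ℕ} (hj : j ≤ n) :
    walk x (insertBlock n m a ξ) j = walk x ξ j := by
  unfold walk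
  congr 1
  refine Finset.sum_congr rfl fun i hi => ?_
  have : i < n := (Finset.mem_range.1 hi).trans_le hj
  simp [insertBlock, this]

lemma walk_insertBlock_add_left (h : walk x ξ n = y 0) {i : ℕ} (hi : i ≤ m) :
    walk x (insertBlock n m (pathSteps y) ξ) (n + i) = y i := by
  induction i with
  | zero => rw [add_zero, walk_insertBlock_of_le _ le_rfl, h]
  | succ i ih =>
    have hstep : insertBlock n m (pathSteps y) ξ (n + i) = y (i + 1) - y i := by
      have h2 : n + i < n + m := by omega
      simp [insertBlock, pathSteps, h2]
    rw [← add_assoc, walk_succ, ih (by omega), hstep]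
    abel

lemma walk_insertBlock_add_right (h : walk x ξ n = y 0) (hy : y m = y 0) {j : ℕ} (hj : n ≤ j) :
    walk x (insertBlock n m (pathSteps y) ξ) (j + m) = walk x ξ j := by
  induction j, hj using Nat.le_induction with
  | base => rw [walk_insertBlock_add_left h le_rfl, hy, h]
  | succ j hj ih =>
    have hstep : insertBlock n m (pathSteps y) ξ (j + m) = ξ j := by
      have h1 : ¬ j + m < n := by omega
      have h2 : ¬ j + m < n + m := by omega
      simp [insertBlock, h1, h2]
    rw [add_right_comm, walk_succ, ih, hstep, walk_succ]

lemma encard_visits_insertBlock (h : walk x ξ n = y 0) (hy : y m = y 0) (z : Lattice d) :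
    {j | walk x (insertBlock n m (pathSteps y) ξ) j = z}.encard =
      {j | walk x ξ j = z}.encard +
        ((∑ k ∈ Finset.Icc 1 m, if y k = z then 1 else 0 : ℕ) : ℕ∞) := by
  -- Time `n` stays with the old visits, so the inserted visits are at `n + 1, …, n + m`, matching
  -- the sum over `1 ≤ k ≤ m` in `ℓ`.
  let f : ℕ → ℕ := fun j => if j ≤ n then j else j + m
  have hf : Function.Injective f := by
    intro i j h
    simp only [f] at h
    split_ifs at h <;> omega
  have hwf (j : ℕ) : walk x (insertBlock n m (pathSteps y) ξ) (f j) = walk x ξ j := by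
    by_cases hj : j ≤ n
    · simp [f, hj, walk_insertBlock_of_le]
    · simp only [f, hj, if_false]
      exact walk_insertBlock_add_right h hy (by omega)
  have hset : {j | walk x (insertBlock n m (pathSteps y) ξ) j = z} =
      f '' {j | walk x ξ j = z} ∪
        (n + ·) '' ((Finset.Icc 1 m).filter (y · = z) : Set ℕ) := by
    ext j
    simp only [Set.mem_ofPred_eq, Set.mem_union, Set.mem_image, Finset.mem_coe,
      Finset.mem_filter, Finset.mem_Icc]
    constructor
    · intro hj
      by_cases h1 : j ≤ n
      · have : f j = j := by simp [f, h1]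
        exact Or.inl ⟨j, by rw [← hwf, this, hj], this⟩
      by_cases h2 : j ≤ n + m
      · obtain ⟨i, rfl⟩ := Nat.exists_eq_add_of_le (le_of_not_ge h1)
        refine Or.inr ⟨i, ⟨by omega, ?_⟩, rfl⟩
        rw [← hj, walk_insertBlock_add_left h (by omega)]
      · have : f (j - m) = j := by
          simp only [f]
          split_ifs <;> omega
        exact Or.inl ⟨j - m, by rw [← hwf, this, hj], this⟩
    · rintro (⟨i, hi, rfl⟩ | ⟨i, ⟨hi, hyi⟩, rfl⟩)
      · rw [hwf, hi]
      · rw [walk_insertBlock_add_left h hi.2, hyi]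
  have hdisj : Disjoint (f '' {j | walk x ξ j = z})
      ((n + ·) '' ((Finset.Icc 1 m).filter (y · = z) : Set ℕ)) := by
    rw [Set.disjoint_left]
    rintro _ ⟨j, -, rfl⟩ ⟨i, hi, hij⟩
    simp only [Finset.mem_coe, Finset.mem_filter, Finset.mem_Icc] at hi
    simp only [f] at hij
    split_ifs at hij <;> omega
  rw [hset, Set.encard_union_eq hdisj, hf.encard_image,
    (add_right_injective n).encard_image, Set.encard_coe_eq_coe_finsetCard, Finset.card_filter]

end Walk

/-! ### Splicing at the first visit to a site, and measurability. -/

section Config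

variable {d : ℕ}

/-- Insert the loop `y 0, …, y m` into the trajectory of particle `k` at time `n`. -/
def insertLoop (k n m : ℕ) (y : ℕ → Lattice d) (ω : Config d) : Config d :=
  (ω.1, ω.2.1, Function.update ω.2.2 k (insertBlock n m (pathSteps y) (ω.2.2 k)))

lemma measurable_insertLoop (k n m : ℕ) (y : ℕ → Lattice d) :
    Measurable (insertLoop k n m y) := by
  have := measurable_insertBlock n m (pathSteps y)
  unfold insertLoop
  fun_prop

/-- In `ω`, the site `x₀` is visited by particle `k` at time `n`, by no particle of smaller index,
and not before time `n` by particle `k`. -/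
def FirstVisit (x₀ : Lattice d) (k n : ℕ) (ω : Config d) : Prop :=
  k < ω.1 ∧ walk (ω.2.1 k) (ω.2.2 k) n = x₀ ∧
    (∀ j < n, walk (ω.2.1 k) (ω.2.2 k) j ≠ x₀) ∧
      ∀ k' < k, ∀ j, walk (ω.2.1 k') (ω.2.2 k') j ≠ x₀

lemma FirstVisit.unique {x₀ : Lattice d} {k n k' n' : ℕ} {ω : Config d}
    (h : FirstVisit x₀ k n ω) (h' : FirstVisit x₀ k' n' ω) : k = k' ∧ n = n' := by
  obtain ⟨-, h2, h3, h4⟩ := h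
  obtain ⟨-, h2', h3', h4'⟩ := h'
  have hk : k = k' := by
    rcases lt_trichotomy k k' with hlt | heq | hlt
    · exact absurd h2 (h4' k hlt n)
    · exact heq
    · exact absurd h2' (h4 k' hlt n')
  subst hk
  refine ⟨rfl, ?_⟩
  rcases lt_trichotomy n n' with hlt | heq | hlt
  · exact absurd h2 (h3' n hlt)
  · exact heq
  · exact absurd h2' (h3 n' hlt)

lemma exists_firstVisit {x₀ : Lattice d} {ω : Config d} (h : localTime ω x₀ ≠ 0) :
    ∃ k n, FirstVisit x₀ k n ω := by
  classical
  obtain ⟨k, hk, hne⟩ := Finset.exists_ne_zero_of_sum_ne_zero h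
  have hex : ∃ k n, walk (ω.2.1 k) (ω.2.2 k) n = x₀ := ⟨k, Set.encard_ne_zero.1 hne⟩
  refine ⟨Nat.find hex, Nat.find (Nat.find_spec hex), ?_, Nat.find_spec (Nat.find_spec hex),
    fun j hj => Nat.find_min (Nat.find_spec hex) hj,
    fun k' hk' j hj => Nat.find_min hex hk' ⟨j, hj⟩⟩
  exact (Nat.find_min' hex (Set.encard_ne_zero.1 hne)).trans_lt (Finset.mem_range.1 hk)

/-- Positions up to time `n` and particles other than `k` are untouched. -/
lemma FirstVisit.insertLoop {x₀ : Lattice d} {k n m : ℕ} {y : ℕ → Lattice d} {ω : Config d}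
    (h : FirstVisit x₀ k n ω) : FirstVisit x₀ k n (insertLoop k n m y ω) := by
  obtain ⟨h1, h2, h3, h4⟩ := h
  refine ⟨h1, ?_, fun j hj => ?_, fun k' hk' j => ?_⟩
  · simpa [Interlacement.insertLoop, walk_insertBlock_of_le] using h2
  · simpa [Interlacement.insertLoop, walk_insertBlock_of_le _ hj.le] using h3 j hj
  · simpa [Interlacement.insertLoop, hk'.ne] using h4 k' hk' j

lemma localTime_insertLoop {k n m : ℕ} {y : ℕ → Lattice d} {ω : Config d} (hk : k < ω.1)
    (h : walk (ω.2.1 k) (ω.2.2 k) n = y 0) (hy : y m = y 0) (z : Lattice d) :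
    localTime (insertLoop k n m y ω) z =
      localTime ω z + ((∑ k ∈ Finset.Icc 1 m, if y k = z then 1 else 0 : ℕ) : ℕ∞) := by
  have hk' : k ∈ Finset.range ω.1 := Finset.mem_range.2 hk
  unfold localTime
  change ∑ i ∈ Finset.range ω.1, _ = _
  rw [← Finset.add_sum_erase _ _ hk', ← Finset.add_sum_erase _ _ hk', add_right_comm]
  congr 1
  · simpa [insertLoop] using encard_visits_insertBlock h hy z
  · refine Finset.sum_congr rfl fun i hi => ?_
    simp [insertLoop, Finset.ne_of_mem_erase hi]

lemma insertLoop_mem_localTimeEvent {A : Finset (Lattice d)} {η : A → ℕ} {k n m : ℕ}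
    {y : ℕ → Lattice d} {ω : Config d} (hω : ω ∈ localTimeEvent A η)
    (hv : FirstVisit (y 0) k n ω) (hy : y m = y 0) :
    insertLoop k n m y ω ∈ localTimeEvent A (η + loopLocalTime A m y) := by
  intro x
  rw [localTime_insertLoop hv.1 hv.2.1 hy, hω x]
  simp [loopLocalTime]

lemma measurable_walk (k n : ℕ) :
    Measurable fun ω : Config d => walk (ω.2.1 k) (ω.2.2 k) n := by
  unfold walk
  fun_prop

lemma measurable_localTime (x : Lattice d) : Measurable fun ω : Config d => localTime ω x := by
  have hwalk (k n : ℕ) : Measurable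
      fun ω : (ℕ → Lattice d) × (ℕ → ℕ → Lattice d) => walk (ω.1 k) (ω.2 k) n := by
    unfold walk
    fun_prop
  have hset (k : ℕ) : Measurable
      fun ω : (ℕ → Lattice d) × (ℕ → ℕ → Lattice d) => {n | walk (ω.1 k) (ω.2 k) n = x} :=
    measurable_set_iff.2 fun n =>
      measurableSet_setOfPred.1 ((measurableSet_singleton x).preimage (hwalk k n))
  have hN (N : ℕ) : Measurable
      fun ω : (ℕ → Lattice d) × (ℕ → ℕ → Lattice d) => localTime ((N, ω) : Config d) x :=
    Finset.measurable_fun_sum (Finset.range N) fun k _ => measurable_encard.comp (hset k)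
  exact measurable_from_prod_countable_right hN

lemma measurableSet_localTimeEvent (A : Finset (Lattice d)) (η : A → ℕ) :
    MeasurableSet (localTimeEvent A η) := by
  simp only [localTimeEvent, Set.ofPred_forall]
  exact MeasurableSet.iInter fun x => measurable_localTime x.1 (measurableSet_singleton _)

lemma measurableSet_firstVisit (x₀ : Lattice d) (k n : ℕ) :
    MeasurableSet {ω : Config d | FirstVisit x₀ k n ω} := by
  have hw (k n : ℕ) : MeasurableSet {ω : Config d | walk (ω.2.1 k) (ω.2.2 k) n = x₀} :=
    measurable_walk k n (measurableSet_singleton x₀)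
  have hk : MeasurableSet {ω : Config d | k < ω.1} :=
    measurableSet_lt measurable_const measurable_fst
  simp only [FirstVisit, Set.ofPred_and, Set.ofPred_forall]
  refine hk.inter ((hw k n).inter (MeasurableSet.inter ?_ ?_))
  · exact MeasurableSet.iInter fun j => MeasurableSet.iInter fun _ => (hw k j).compl
  · exact MeasurableSet.iInter fun k' => MeasurableSet.iInter fun _ =>
      MeasurableSet.iInter fun j => (hw k' j).compl

end Config

/-! ### Comparison of the interlacement law with its image under splicing. -/

section Law

variable {d : ℕ}

lemma smul_map_prodMap_id_le {X Y : Type*} [MeasurableSpace X] [MeasurableSpace Y]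
    (μ : Measure X) (ν : Measure Y) [SFinite ν] {c : ℝ≥0∞} {f : Y → Y} (hf : Measurable f)
    (h : c • ν.map f ≤ ν) : c • (μ.prod ν).map (Prod.map id f) ≤ μ.prod ν := by
  refine Measure.le_iff.2 fun E hE => ?_
  have hpre : MeasurableSet (Prod.map (id : X → X) f ⁻¹' E) := (measurable_id.prodMap hf) hE
  rw [Measure.smul_apply, Measure.map_apply (measurable_id.prodMap hf) hE,
    Measure.prod_apply hpre, Measure.prod_apply hE, smul_eq_mul,
    ← lintegral_const_mul _ (measurable_measure_prodMk_left hpre)]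
  refine lintegral_mono fun x => ?_
  have hx := h (Prod.mk x ⁻¹' E)
  rwa [Measure.smul_apply, Measure.map_apply hf (measurable_prodMk_left hE)] at hx

lemma isProbabilityMeasure_normalizedHarmonicMeasure {A : Finset (Lattice d)}
    (hA : capacity A ≠ 0) : IsProbabilityMeasure (normalizedHarmonicMeasure A) := by
  refine ⟨?_⟩
  have : ∑ x ∈ A, harmonicMeasure A x / capacity A = 1 := by
    rw [← Finset.sum_div]
    exact div_self hA
  simp only [normalizedHarmonicMeasure, Measure.finsetSum_apply, Measure.smul_apply,
    measure_univ, ENNReal.smul_def, smul_eq_mul, mul_one]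
  exact_mod_cast this

lemma isProbabilityMeasure_stepsLaw (hd : 0 < d) : IsProbabilityMeasure (stepsLaw d) :=
  have := isProbabilityMeasure_stepLaw hd
  inferInstanceAs (IsProbabilityMeasure (Measure.infinitePi fun _ : ℕ => stepLaw d))

lemma isProbabilityMeasure_interlacementLaw (hd : 0 < d) {A : Finset (Lattice d)}
    (hA : capacity A ≠ 0) (u : ℝ≥0) : IsProbabilityMeasure (interlacementLaw A u) := by
  have := isProbabilityMeasure_stepsLaw hd
  have := isProbabilityMeasure_normalizedHarmonicMeasure hA
  unfold interlacementLaw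
  infer_instance

/-- Inserting a nearest-neighbour path of `m` steps costs a factor of at most `(2d)^m`. -/
lemma smul_map_insertLoop_le (hd : 0 < d) {A : Finset (Lattice d)} (hA : capacity A ≠ 0)
    (u : ℝ≥0) (k n : ℕ) {m : ℕ}
    {y : ℕ → Lattice d} (hy : ∀ i < m, Adj (y i) (y (i + 1))) :
    ((2 * d : ℝ≥0∞)⁻¹ ^ m) • (interlacementLaw A u).map (insertLoop k n m y) ≤
      interlacementLaw A u := by
  have := isProbabilityMeasure_stepLaw hd
  have := isProbabilityMeasure_stepsLaw hd
  have := isProbabilityMeasure_normalizedHarmonicMeasure hA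
  have hblock := measurable_insertBlock n m (pathSteps y)
  have hsteps : ((2 * d : ℝ≥0∞)⁻¹ ^ m) • (stepsLaw d).map (insertBlock n m (pathSteps y)) ≤
      stepsLaw d := by
    refine le_trans ?_ (smul_map_insertBlock_le (stepLaw d) n m (pathSteps y))
    refine Measure.le_iff.2 fun E _ => ?_
    rw [Measure.smul_apply, Measure.smul_apply, smul_eq_mul, smul_eq_mul]
    refine mul_le_mul_left ?_ _
    calc (2 * d : ℝ≥0∞)⁻¹ ^ m = ∏ _i ∈ Finset.range m, (2 * d : ℝ≥0∞)⁻¹ := by simp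
      _ ≤ _ := Finset.prod_le_prod' fun i hi =>
      inv_two_mul_le_stepLaw_singleton (hy i (Finset.mem_range.1 hi)).sub
  have hupdate : Measurable fun ξ : ℕ → ℕ → Lattice d =>
      Function.update ξ k (insertBlock n m (pathSteps y) (ξ k)) := by fun_prop
  exact smul_map_prodMap_id_le _ _ (measurable_id.prodMap hupdate)
    (smul_map_prodMap_id_le _ _ hupdate (smul_map_update_le _ hblock hsteps k))

lemma smul_interlacementLaw_le (hd : 0 < d) {A : Finset (Lattice d)} (hA : capacity A ≠ 0)
    (u : ℝ≥0) {m : ℕ} {y : ℕ → Lattice d} (hy : ∀ i < m, Adj (y i) (y (i + 1))) (hloop : y m = y 0) {η : A → ℕ}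
    {x₀ : A} (hx₀ : y 0 = x₀) (hη : η x₀ ≠ 0) :
    (2 * d : ℝ≥0∞)⁻¹ ^ m * interlacementLaw A u (localTimeEvent A η) ≤
      interlacementLaw A u (localTimeEvent A (η + loopLocalTime A m y)) := by
  set P := interlacementLaw A u
  set E' := localTimeEvent A (η + loopLocalTime A m y)
  let F (p : ℕ × ℕ) : Set (Config d) := {ω | FirstVisit (y 0) p.1 p.2 ω}
  have hF (p : ℕ × ℕ) : MeasurableSet (E' ∩ F p) :=
    (measurableSet_localTimeEvent A _).inter (measurableSet_firstVisit _ _ _)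
  have hcover : localTimeEvent A η ⊆ ⋃ p, localTimeEvent A η ∩ F p := by
    intro ω hω
    obtain ⟨k, n, hkn⟩ : ∃ k n, FirstVisit (y 0) k n ω :=
      exists_firstVisit (by rw [hx₀, hω x₀]; exact_mod_cast hη)
    exact Set.mem_iUnion.2 ⟨(k, n), hω, hkn⟩
  have hdisj : Pairwise (Function.onFun Disjoint fun p => E' ∩ F p) := by
    intro p q hpq
    refine Set.disjoint_left.2 fun ω hp hq => hpq ?_
    exact Prod.ext_iff.2 (FirstVisit.unique hp.2 hq.2)
  have hpiece (p : ℕ × ℕ) :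
      (2 * d : ℝ≥0∞)⁻¹ ^ m * P (localTimeEvent A η ∩ F p) ≤ P (E' ∩ F p) := by
    have h := smul_map_insertLoop_le hd hA u p.1 p.2 hy (E' ∩ F p)
    rw [Measure.smul_apply, Measure.map_apply (measurable_insertLoop _ _ _ _) (hF p),
      smul_eq_mul] at h
    -- Splicing at `p` maps the piece for `η` into `E' ∩ F p`, so the former lies in the preimage of
    -- the latter.
    refine le_trans (mul_le_mul_right (measure_mono fun ω hω => ?_) _) h
    exact ⟨insertLoop_mem_localTimeEvent hω.1 hω.2 hloop, FirstVisit.insertLoop hω.2⟩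
  calc (2 * d : ℝ≥0∞)⁻¹ ^ m * P (localTimeEvent A η)
      ≤ (2 * d : ℝ≥0∞)⁻¹ ^ m * ∑' p, P (localTimeEvent A η ∩ F p) :=
        mul_le_mul_right ((measure_mono hcover).trans (measure_iUnion_le _)) _
    _ = ∑' p, (2 * d : ℝ≥0∞)⁻¹ ^ m * P (localTimeEvent A η ∩ F p) := ENNReal.tsum_mul_left.symm
    _ ≤ ∑' p, P (E' ∩ F p) := ENNReal.tsum_le_tsum hpiece
    _ = P (⋃ p, E' ∩ F p) := (measure_iUnion hdisj hF).symm
    _ ≤ P E' := measure_mono (Set.iUnion_subset fun p => Set.inter_subset_left)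

end Law

end Interlacement

namespace Interlacement

/-- Without capacity there are almost surely no particles. -/
lemma interlacementLaw_localTimeEvent_eq_zero {d : ℕ} {A : Finset (Lattice d)}
    (hA : capacity A = 0) (u : ℝ≥0) {η : A → ℕ} {x : A} (hη : η x ≠ 0) :
    interlacementLaw A u (localTimeEvent A η) = 0 := by
  unfold interlacementLaw
  -- Division by zero capacity makes the starting law the zero measure, so the product is unfolded
  -- as a bind rather than treated as a product of probability measures.
  rw [hA, mul_zero, Measure.prod_def, Measure.bind_apply (measurableSet_localTimeEvent A η)
    (measurable_of_countable _).aemeasurable, lintegral_countable']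
  refine ENNReal.tsum_eq_zero.2 fun N => ?_
  rcases Nat.eq_zero_or_pos N with rfl | hN
  · rw [Measure.map_apply measurable_prodMk_left (measurableSet_localTimeEvent A η)]
    have : Prod.mk 0 ⁻¹' localTimeEvent A η = ∅ := by
      refine Set.eq_empty_of_forall_notMem fun ω hω => hη ?_
      have h := hω x
      simp only [localTime, Finset.range_zero, Finset.sum_empty] at h
      exact_mod_cast h.symm
    rw [this, measure_empty, zero_mul]
  · rw [poissonMeasure_singleton]
    simp [hN.ne']

end Interlacement

theorem mainTheorem4 (d : ℕ) (hd : 3 ≤ d) (u : ℝ≥0) (hu : 0 < u)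
    (A : Finset (Interlacement.Lattice d)) (x₀ : A)
    (m : ℕ) (y : ℕ → Interlacement.Lattice d)
    (hy_start : y 0 = x₀) (hy_end : y m = x₀)
    (hy_adj : ∀ k < m, Interlacement.Adj (y k) (y (k + 1)))
    (hy_int : ∀ k ≤ m, y k ∈ (A : Set (Interlacement.Lattice d)) \
      Interlacement.innerBoundary (A : Set (Interlacement.Lattice d)))
    (η : A → ℕ) (hη : η x₀ = 1) :
    (2 * (d : ℝ)) ^ (-(m : ℤ)) *
        (Interlacement.interlacementLaw A u).real (Interlacement.localTimeEvent A η) ≤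
      (Interlacement.interlacementLaw A u).real
        (Interlacement.localTimeEvent A (η + Interlacement.loopLocalTime A m y)) := by
  have hη' : η x₀ ≠ 0 := by rw [hη]; exact one_ne_zero
  -- Transience would exclude zero capacity; treating the case directly, where the left side
  -- vanishes, avoids proving it.
  by_cases hA : Interlacement.capacity A = 0
  · rw [Measure.real, Interlacement.interlacementLaw_localTimeEvent_eq_zero hA u hη',
      ENNReal.toReal_zero, mul_zero]
    exact measureReal_nonneg
  · have hd0 : 0 < d := by omega
    have := Interlacement.isProbabilityMeasure_interlacementLaw hd0 hA u
    have h := ENNReal.toReal_mono (measure_ne_top _ _)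
      (Interlacement.smul_interlacementLaw_le hd0 hA u hy_adj (hy_end.trans hy_start.symm)
        hy_start hη')
    rw [ENNReal.toReal_mul] at h
    rw [zpow_neg, zpow_natCast, ← inv_pow]
    simpa [Measure.real, mul_comm] using h
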